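/- Let $X$ and $Y$ be proper geodesic metric spaces, let $f\colon X\to Y$ be a (not necessarily continuous) $(\lambda,\epsilon)$-quasi-isometric embedding with $\lambda\ge 1$, $\epsilon\ge 0$, that is, $\frac1\lambda d(a,b)-\epsilon\le d(f(a),f(b))\le\lambda d(a,b)+\epsilon$ for all $a,b\in X$, and let $p\in X$. A Morse gauge is a function $N\colon[1,\infty)\times[0,\infty)\to[0,\infty)$. A geodesic ray $\gamma\colon[0,\infty)\to X$ (an isometric embedding) is $N$-Morse if, for all $\lambda'\ge1$, $\epsilon'\ge0$, every $(\lambda',\epsilon')$-quasi-geodesic $\sigma\colon[a,b]\to X$ with endpoints on $\gamma$ lies in the closed $N(\lambda',\epsilon')$-neighbourhood of $\gamma$; it is Morse if it is $N$-Morse for some $N$. The Morse boundary $\partial_M X_p$ is the set of Morse geodesic rays $\gamma$ with $\gamma(0)=p$, where $\gamma\sim\gamma'$ if $\sup_t d(\gamma(t),\gamma'(t))<\infty$. Let $\partial_M^N X_p\subset\partial_M X_p$ be the set of classes that contain an $N$-Morse ray from $p$. In $\partial_M^N X_p$ say that $x_n\to x$ if there are $N$-Morse rays $\alpha_n$ from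 $p$ with $[\alpha_n]=x_n$ such that every subsequence of $(\alpha_n)$ has a subsequence that converges uniformly on compact sets to a geodesic ray $\alpha$ with $[\alpha]=x$; a subset of $\partial_M^N X_p$ is closed if it contains the limits of all its convergent sequences. Give $\partial_M X_p=\varinjlim_N\partial_M^N X_p$ the direct limit topology over all Morse gauges with the pointwise order: a subset is open if and only if its intersection with every $\partial_M^N X_p$ is open in $\partial_M^N X_p$. Suppose that $f$ induces a Morse preserving map: for every Morse gauge $N$ there is a Morse gauge $N'$ such that for every $N$-Morse geodesic ray $\gamma$ in $X$ with $\gamma(0)=p$ there is an $N'$-Morse geodesic ray in $Y$ that starts at $f(p)$ and is at finite Hausdorff distance from $f\circ\gamma$. Let $\partial_M f\colon\partial_M X_p\to\partial_M Y_{f(p)}$ be the (well-defined) map that sends $[\gamma]$ to the class of the Morse rays from $f(p)$ at finite Hausdorff distance from $f\circ\gamma$. Then $\partial_M f$ is a homeomorphism from $\partial_M X_p$ onto its image $\partial_M f(\partial_M X_p)$ with the subspace topology of $\partial_M Y_{f(p)}$, that is, $\partial_M f$ is a topological embedding. -/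

import Mathlib

open scoped NNReal
open Filter Topology

namespace MorseBdry

/-- `X` is a geodesic space: any two points are joined by an isometrically embedded segment. -/
def IsGeodesicSpace (X : Type*) [MetricSpace X] : Prop :=
  ∀ x y : X, ∃ c : ℝ → X, c 0 = x ∧ c (dist x y) = y ∧
    ∀ s ∈ Set.Icc 0 (dist x y), ∀ t ∈ Set.Icc 0 (dist x y), dist (c s) (c t) = |s - t|

/-- `f` is a `(lam, ε)`-quasi-isometric embedding (no continuity is required). -/
def IsQuasiIsometricEmbedding {A B : Type*} [MetricSpace A] [MetricSpace B]
    (lam ε : ℝ) (f : A → B) : Prop :=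
  1 ≤ lam ∧ 0 ≤ ε ∧ ∀ a b : A,
    1 / lam * dist a b - ε ≤ dist (f a) (f b) ∧ dist (f a) (f b) ≤ lam * dist a b + ε

/-- A Morse gauge: an arbitrary function `[1, ∞) × [0, ∞) → [0, ∞)`. -/
abbrev MorseGauge : Type := Set.Ici (1 : ℝ) → ℝ≥0 → ℝ≥0

/-- The ray `γ : [0, ∞) → X` is `N`-Morse: each `(lam, ε)`-quasi-geodesic `σ : [a, b] → X` with
both endpoints on `γ` lies in the (closed) `N (lam, ε)`-neighbourhood of `γ`. -/
def IsMorse {X : Type*} [MetricSpace X] (N : MorseGauge) (γ : ℝ≥0 → X) : Prop :=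
  ∀ (lam : Set.Ici (1 : ℝ)) (ε : ℝ≥0) (a b : ℝ), a ≤ b → ∀ σ : ℝ → X,
    IsQuasiIsometricEmbedding lam ε (fun t : Set.Icc a b => σ t) →
    σ a ∈ Set.range γ → σ b ∈ Set.range γ →
    ∀ t ∈ Set.Icc a b, ∃ s : ℝ≥0, dist (σ t) (γ s) ≤ N lam ε

/-- A Morse geodesic ray in `X` with basepoint `p`. -/
structure MorseRay (X : Type*) [MetricSpace X] (p : X) where
  toFun : ℝ≥0 → X
  isometry : Isometry toFun
  base : toFun 0 = p
  morse : ∃ N : MorseGauge, IsMorse N toFun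

instance morseRayCoeFun {X : Type*} [MetricSpace X] {p : X} : CoeFun (MorseRay X p) (fun _ => ℝ≥0 → X) :=
  ⟨MorseRay.toFun⟩

/-- Two rays are asymptotic if they stay at bounded distance from each other. -/
def Asymptotic {X : Type*} [MetricSpace X] (γ γ' : ℝ≥0 → X) : Prop :=
  ∃ K : ℝ, ∀ t : ℝ≥0, dist (γ t) (γ' t) < K

instance morseRaySetoid (X : Type*) [MetricSpace X] (p : X) : Setoid (MorseRay X p) where
  r γ γ' := Asymptotic γ γ'
  iseqv :=
    { refl := fun γ => ⟨1, fun t => by simp⟩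
      symm := fun ⟨K, h⟩ => ⟨K, fun t => by rw [dist_comm]; exact h t⟩
      trans := fun ⟨K, h⟩ ⟨L, k⟩ =>
        ⟨K + L, fun t => (dist_triangle _ _ _).trans_lt (add_lt_add (h t) (k t))⟩ }

/-- The Morse boundary of `X` with basepoint `p`, as a set. -/
def MorseBoundary (X : Type*) [MetricSpace X] (p : X) : Type _ :=
  Quotient (morseRaySetoid X p)

/-- The class of a Morse ray in the Morse boundary. -/
def MorseBoundary.mk {X : Type*} [MetricSpace X] {p : X} (γ : MorseRay X p) : MorseBoundary X p :=
  Quotient.mk (morseRaySetoid X p) γ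

/-- The `N`-Morse boundary: the classes that contain an `N`-Morse ray with basepoint `p`. -/
def stratum (X : Type*) [MetricSpace X] (p : X) (N : MorseGauge) : Set (MorseBoundary X p) :=
  {ξ | ∃ β : MorseRay X p, MorseBoundary.mk β = ξ ∧ IsMorse N β}

/-- Convergence of a sequence in the `N`-Morse boundary: there are `N`-Morse representatives such
that each subsequence has a further subsequence that converges, uniformly on compact sets, to a
geodesic ray in the limit class. -/
def StratumTendsto {X : Type*} [MetricSpace X] {p : X} {N : MorseGauge}
    (x : ℕ → stratum X p N) (ξ : stratum X p N) : Prop :=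
  ∃ α : ℕ → MorseRay X p,
    (∀ n, IsMorse N (α n) ∧ MorseBoundary.mk (α n) = x n) ∧
    ∀ φ : ℕ → ℕ, StrictMono φ → ∃ ψ : ℕ → ℕ, StrictMono ψ ∧
      ∃ β : MorseRay X p, MorseBoundary.mk β = ξ ∧
        ∀ K : Set ℝ≥0, IsCompact K →
          TendstoUniformlyOn (fun n => (α (φ (ψ n))).toFun) β.toFun atTop K

theorem StratumTendsto.comp {X : Type*} [MetricSpace X] {p : X} {N : MorseGauge}
    {x : ℕ → stratum X p N} {ξ : stratum X p N} (h : StratumTendsto x ξ)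
    {φ : ℕ → ℕ} (hφ : StrictMono φ) : StratumTendsto (x ∘ φ) ξ := by
  obtain ⟨α, h1, h2⟩ := h
  exact ⟨α ∘ φ, fun n => h1 (φ n), fun χ hχ => h2 (φ ∘ χ) (hφ.comp hχ)⟩

/-- The topology of the `N`-Morse boundary: the closed sets are those that contain the limits of
their convergent sequences. -/
@[reducible] def stratumTopology (X : Type*) [MetricSpace X] (p : X) (N : MorseGauge) :
    TopologicalSpace (stratum X p N) :=
  TopologicalSpace.ofClosed
    {B | ∀ (x : ℕ → stratum X p N) (ξ : stratum X p N),
      (∀ n, x n ∈ B) → StratumTendsto x ξ → ξ ∈ B}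
    (fun _ _ hx _ => (hx 0).elim)
    (fun _ hA x ξ hx hξ B hB => hA hB x ξ (fun n => hx n B hB) hξ)
    (by
      intro A hA B hB x ξ hx hξ
      by_cases hfr : ∃ᶠ n in atTop, x n ∈ A
      · obtain ⟨φ, hφ, h⟩ := extraction_of_frequently_atTop hfr
        exact Or.inl (hA _ ξ h (hξ.comp hφ))
      · obtain ⟨φ, hφ, h⟩ := extraction_of_eventually_atTop (not_frequently.1 hfr)
        exact Or.inr (hB _ ξ (fun n => (hx (φ n)).resolve_left (h n)) (hξ.comp hφ)))

/-- The direct limit topology on the Morse boundary. Since `N ≤ N'` makes the `N`-Morse boundary a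
subset of the `N'`-Morse boundary and any two gauges have a common upper bound, the direct limit
is the union of the `N`-Morse boundaries with the final topology for their inclusions: a set is
open if and only if its trace on every `N`-Morse boundary is open. -/
instance morseBoundaryTopology (X : Type*) [MetricSpace X] (p : X) :
    TopologicalSpace (MorseBoundary X p) :=
  ⨆ N : MorseGauge,
    TopologicalSpace.coinduced (Subtype.val : stratum X p N → MorseBoundary X p)
      (stratumTopology X p N)

/-- The images of two maps are at finite Hausdorff distance. -/
def BoundedHausdorff {A B X : Type*} [MetricSpace X] (γ : A → X) (β : B → X) : Prop :=
  Metric.hausdorffEDist (Set.range γ) (Set.range β) ≠ ⊤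

/-- `f` induces a Morse preserving map on the Morse boundaries with basepoints `p` and `f p`:
for each gauge `N` there is a gauge `N'` such that for each `N`-Morse geodesic ray `γ` from `p`
there is an `N'`-Morse geodesic ray from `f p` at finite Hausdorff distance from `f ∘ γ`. -/
def InducesMorsePreserving {X Y : Type*} [MetricSpace X] [MetricSpace Y] (f : X → Y) (p : X) :
    Prop :=
  ∀ N : MorseGauge, ∃ N' : MorseGauge, ∀ γ : MorseRay X p, IsMorse N γ →
    ∃ β : MorseRay Y (f p), IsMorse N' β ∧ BoundedHausdorff β (f ∘ γ)

theorem BoundedHausdorff.symm {A B X : Type*} [MetricSpace X] {γ : A → X} {β : B → X}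
    (h : BoundedHausdorff γ β) : BoundedHausdorff β γ := by
  unfold BoundedHausdorff at *
  rwa [Metric.hausdorffEDist_comm]

theorem BoundedHausdorff.trans {A B C X : Type*} [MetricSpace X] {γ : A → X} {β : B → X}
    {α : C → X} (h : BoundedHausdorff γ β) (h' : BoundedHausdorff β α) : BoundedHausdorff γ α :=
  ne_top_of_le_ne_top (ENNReal.add_ne_top.2 ⟨h, h'⟩) Metric.hausdorffEDist_triangle

theorem boundedHausdorff_of_dist_le {A X : Type*} [MetricSpace X] {γ β : A → X} (K : ℝ)
    (h : ∀ t, dist (γ t) (β t) ≤ K) : BoundedHausdorff γ β := by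
  refine ne_top_of_le_ne_top (ENNReal.ofReal_ne_top (r := K))
    (Metric.hausdorffEDist_le_of_mem_edist ?_ ?_)
  · rintro _ ⟨t, rfl⟩
    exact ⟨β t, ⟨t, rfl⟩, by rw [edist_dist]; exact ENNReal.ofReal_le_ofReal (h t)⟩
  · rintro _ ⟨t, rfl⟩
    exact ⟨γ t, ⟨t, rfl⟩, by
      rw [edist_dist, dist_comm]; exact ENNReal.ofReal_le_ofReal (h t)⟩

/-- Rays with a common basepoint are asymptotic if and only if they are at finite Hausdorff
distance. -/
theorem MorseBoundary.mk_eq_mk_iff {X : Type*} [MetricSpace X] {p : X} (γ β : MorseRay X p) :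
    MorseBoundary.mk γ = MorseBoundary.mk β ↔ BoundedHausdorff γ β := by
  constructor
  · intro h
    obtain ⟨K, hK⟩ := Quotient.exact h
    exact boundedHausdorff_of_dist_le K fun t => (hK t).le
  · intro h
    obtain ⟨r, hr⟩ : ∃ r : ℝ≥0, Metric.hausdorffEDist (Set.range γ) (Set.range β) < r :=
      ENNReal.lt_iff_exists_nnreal_btwn.1 (lt_top_iff_ne_top.2 h) |>.imp fun r hr => hr.1
    refine Quotient.sound ⟨2 * r, fun t => ?_⟩
    obtain ⟨_, ⟨s, rfl⟩, hs⟩ :=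
      Metric.exists_edist_lt_of_hausdorffEDist_lt (Set.mem_range_self t) hr
    have hs' : dist (γ t) (β s) < r := by
      rw [edist_nndist] at hs
      exact_mod_cast hs
    have h1 : dist (γ t) p = t := by
      have := γ.isometry.dist_eq t 0
      rw [γ.base] at this
      rw [this]
      simp [NNReal.dist_eq]
    have h2 : dist (β s) p = s := by
      have := β.isometry.dist_eq s 0
      rw [β.base] at this
      rw [this]
      simp [NNReal.dist_eq]
    have h3 : dist (β s) (β t) = |(s : ℝ) - t| := by
      rw [β.isometry.dist_eq, NNReal.dist_eq]
    have h4 : |(s : ℝ) - t| < r := by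
      rw [← h1, ← h2]
      refine (abs_dist_sub_le _ _ _).trans_lt ?_
      rwa [dist_comm]
    linarith [dist_triangle (γ t) (β s) (β t)]

/-- The map `∂_M f` that sends the class of a Morse ray `γ` from `p` to the class of the Morse
rays from `f p` at finite Hausdorff distance from `f ∘ γ`. -/
noncomputable def boundaryMap {X Y : Type*} [MetricSpace X] [MetricSpace Y] (f : X → Y) (p : X)
    {lam ε : ℝ} (hf : IsQuasiIsometricEmbedding lam ε f) (h : InducesMorsePreserving f p) :
    MorseBoundary X p → MorseBoundary Y (f p) :=
  have key : ∀ γ : MorseRay X p, ∃ β : MorseRay Y (f p), BoundedHausdorff β (f ∘ γ) := fun γ =>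
    let ⟨_, hN⟩ := γ.morse
    let ⟨_, hN'⟩ := h _
    let ⟨β, hβ⟩ := hN' γ hN
    ⟨β, hβ.2⟩
  Quotient.lift (fun γ => MorseBoundary.mk (key γ).choose) (by
    rintro γ γ' ⟨K, hK⟩
    refine (MorseBoundary.mk_eq_mk_iff _ _).2
      ((key γ).choose_spec.trans (.trans ?_ (key γ').choose_spec.symm))
    refine boundedHausdorff_of_dist_le (lam * K + ε) fun t => (hf.2.2 _ _).2.trans ?_
    have := mul_le_mul_of_nonneg_left (hK t).le (zero_le_one.trans hf.1)
    linarith)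

/-- The defining property of `boundaryMap`. -/
theorem boundaryMap_mk_eq_iff {X Y : Type*} [MetricSpace X] [MetricSpace Y] (f : X → Y) (p : X)
    {lam ε : ℝ} (hf : IsQuasiIsometricEmbedding lam ε f) (h : InducesMorsePreserving f p)
    (γ : MorseRay X p) (β : MorseRay Y (f p)) :
    boundaryMap f p hf h (MorseBoundary.mk γ) = MorseBoundary.mk β ↔
      BoundedHausdorff β (f ∘ γ) := by
  have key : ∃ β : MorseRay Y (f p), BoundedHausdorff β (f ∘ γ) :=
    let ⟨_, hN⟩ := γ.morse
    let ⟨_, hN'⟩ := h _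
    let ⟨β, hβ⟩ := hN' γ hN
    ⟨β, hβ.2⟩
  have e : boundaryMap f p hf h (MorseBoundary.mk γ) = MorseBoundary.mk key.choose := rfl
  rw [e, MorseBoundary.mk_eq_mk_iff]
  exact ⟨fun H => H.symm.trans key.choose_spec, fun H => key.choose_spec.trans H.symm⟩

end MorseBdry

namespace MorseBdry

/-! A continuous injective closed map is an embedding, and closed sets of the direct limit are
tested on sequences in a single stratum. So continuity and closedness of `boundaryMap` follow from
one compactness argument. Take Morse rays `γ n` in `X` and `β n` in `Y`, each family with a common
gauge, such that `β n` is at finite Hausdorff distance from `f ∘ γ n`. By Arzelà–Ascoli and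
`IsMorse.of_tendsto` either family subconverges to a Morse ray, and the limits again correspond
under `f` (`boundedHausdorff_of_tendsto`).

The last point needs a bound on the distance from `f ∘ γ n` to `β n` that is uniform in `n`.
`exists_uniform_near` gives it: close up a long piece of `f ∘ γ n` by a geodesic to a far point of
`β n` and apply the Morse property to the resulting quasi-geodesic.

The common gauge in `Y` is the Morse preserving hypothesis. In `X` it comes from
`exists_gauge_of_image`: push quasi-geodesics forward by `f`, use the Morse property in `Y`, and
pull the estimate back. -/

theorem isClosed_iff {X : Type*} [MetricSpace X] {p : X} {C : Set (MorseBoundary X p)} :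
    IsClosed C ↔ ∀ (N : MorseGauge) (x : ℕ → stratum X p N) (ξ : stratum X p N),
      (∀ n, (x n : MorseBoundary X p) ∈ C) → StratumTendsto x ξ → (ξ : MorseBoundary X p) ∈ C := by
  rw [isClosed_iSup_iff]
  refine forall_congr' fun N => ?_
  rw [isClosed_coinduced, ← @isOpen_compl_iff _ _ (stratumTopology X p N)]
  -- `TopologicalSpace.ofClosed` calls a set open when its complement is in the given family, hence
  -- the double complement.
  change (Subtype.val ⁻¹' C)ᶜᶜ ∈ _ ↔ _
  rw [compl_compl]
  rfl

/-! ### Limits of geodesic rays and of Morse rays -/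

section Rays

variable {X : Type*} [MetricSpace X] {p : X}

theorem dist_base_of_isometry {γ : ℝ≥0 → X} (hγ : Isometry γ) (t : ℝ≥0) :
    dist (γ t) (γ 0) = t := by
  rw [hγ.dist_eq]; simp [NNReal.dist_eq]

/-- Arzelà–Ascoli: the rays are 1-Lipschitz, and their values at `t` lie in the compact ball of
radius `t` about `p`. -/
theorem exists_subseq_tendsto_of_isometry [ProperSpace X] (γ : ℕ → ℝ≥0 → X)
    (hγ : ∀ n, Isometry (γ n)) (h0 : ∀ n, γ n 0 = p) :
    ∃ φ : ℕ → ℕ, StrictMono φ ∧ ∃ β : ℝ≥0 → X, Isometry β ∧ β 0 = p ∧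
      ∀ K : Set ℝ≥0, IsCompact K → TendstoUniformlyOn (fun n => γ (φ n)) β atTop K := by
  let S : Set C(ℝ≥0, X) := {g | Isometry g ∧ g 0 = p}
  have hS1 : IsCompact (ContinuousMap.toFun '' S) := by
    have hcl : IsClosed {g : ℝ≥0 → X | (∀ s t, dist (g s) (g t) = dist s t) ∧ g 0 = p} := by
      have : {g : ℝ≥0 → X | ∀ s t, dist (g s) (g t) = dist s t}
          = ⋂ s, ⋂ t, {g | dist (g s) (g t) = dist s t} := by ext; simp
      have hiso : IsClosed {g : ℝ≥0 → X | ∀ s t, dist (g s) (g t) = dist s t} := by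
        rw [this]
        exact isClosed_iInter fun s => isClosed_iInter fun t =>
          isClosed_eq ((continuous_apply s).dist (continuous_apply t)) continuous_const
      exact hiso.inter (isClosed_eq (continuous_apply 0) continuous_const)
    have he : ContinuousMap.toFun '' S
        = {g : ℝ≥0 → X | (∀ s t, dist (g s) (g t) = dist s t) ∧ g 0 = p} := by
      ext g
      constructor
      · rintro ⟨g, ⟨hg, hg0⟩, rfl⟩
        exact ⟨hg.dist_eq, hg0⟩
      · rintro ⟨hg, hg0⟩
        exact ⟨⟨g, (Isometry.of_dist_eq hg).continuous⟩, ⟨Isometry.of_dist_eq hg, hg0⟩, rfl⟩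
    rw [he]
    refine (isCompact_univ_pi fun t : ℝ≥0 => isCompact_closedBall p t).of_isClosed_subset hcl ?_
    rintro g ⟨hg, hg0⟩ t -
    rw [Metric.mem_closedBall, ← hg0, hg]
    simp [NNReal.dist_eq]
  have hS2 : Equicontinuous ((↑) : S → ℝ≥0 → X) := by
    refine UniformEquicontinuous.equicontinuous
      (LipschitzWith.uniformEquicontinuous _ 1 fun g => g.2.1.lipschitz)
  have hS : IsCompact S := ArzelaAscoli.isCompact_of_equicontinuous S hS1 hS2
  obtain ⟨β, hβ, φ, hφ, hlim⟩ := hS.isSeqCompact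
    (x := fun n => ⟨γ n, (hγ n).continuous⟩) fun n => ⟨hγ n, h0 n⟩
  exact ⟨φ, hφ, β, hβ.1, hβ.2, ContinuousMap.tendsto_iff_forall_isCompact_tendstoUniformlyOn.1 hlim⟩

theorem IsMorse.mono {N N' : MorseGauge} (h : ∀ l e, N l e ≤ N' l e) {γ : ℝ≥0 → X}
    (hγ : IsMorse N γ) : IsMorse N' γ := fun l e a b hab σ hσ ha hb t ht =>
  let ⟨s, hs⟩ := hγ l e a b hab σ hσ ha hb t ht
  ⟨s, hs.trans (NNReal.coe_le_coe.2 (h l e))⟩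

/-- A quasi-geodesic with endpoints near a Morse ray stays near that ray. -/
theorem IsMorse.near_of_endpoints_near {N : MorseGauge} {γ : ℝ≥0 → X} (hγ : IsMorse N γ)
    (D : ℝ≥0) (l : Set.Ici (1 : ℝ)) (e : ℝ≥0) {a b : ℝ} (hab : a ≤ b) {σ : ℝ → X}
    (hσ : IsQuasiIsometricEmbedding l e (fun t : Set.Icc a b => σ t))
    (ha : ∃ s, dist (σ a) (γ s) ≤ D) (hb : ∃ s, dist (σ b) (γ s) ≤ D) {t : ℝ}
    (ht : t ∈ Set.Icc a b) : ∃ s, dist (σ t) (γ s) ≤ N l (e + 2 * D) + D := by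
  classical
  -- Quasi-geodesics need not be continuous, so points of `σ` that are `D`-close to `γ` may be moved
  -- onto `γ`. This costs `2 * D` in the additive constant and puts the endpoints on `γ`.
  let τ : ℝ → X := fun t => if h : ∃ s, dist (σ t) (γ s) ≤ D then γ h.choose else σ t
  have hτ : ∀ t, dist (σ t) (τ t) ≤ D := by
    intro t
    by_cases h : ∃ s, dist (σ t) (γ s) ≤ D
    · simpa only [τ, dif_pos h] using h.choose_spec
    · simp only [τ, dif_neg h, dist_self, NNReal.coe_nonneg]
  have hmem : ∀ t, (∃ s, dist (σ t) (γ s) ≤ D) → τ t ∈ Set.range γ := fun t h => by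
    simp only [τ, dif_pos h, Set.mem_range_self]
  obtain ⟨s, hs⟩ := hγ l (e + 2 * D) a b hab τ
    ⟨hσ.1, NNReal.coe_nonneg _, fun x y => by
      have h1 := hσ.2.2 x y
      have h2 := hτ x
      have h3 := hτ y
      have h4 := dist_triangle4 (τ x) (σ x) (σ y) (τ y)
      have h5 := dist_triangle4 (σ x) (τ x) (τ y) (σ y)
      rw [dist_comm (τ x) (σ x)] at h4
      rw [dist_comm (τ y) (σ y)] at h5
      push_cast
      constructor <;> linarith [h1.1, h1.2]⟩ (hmem a ha) (hmem b hb) t ht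
  exact ⟨s, by linarith [dist_triangle (σ t) (τ t) (γ s), hτ t]⟩

/-- For large `n` the endpoints of a quasi-geodesic on `β` are 1-close to `α n`, which gives `N l (e
+ 2) + 1`; returning from `α n` to `β` costs 1 more. -/
theorem IsMorse.of_tendsto {N : MorseGauge} {α : ℕ → ℝ≥0 → X} {β : ℝ≥0 → X}
    (hα : ∀ n, IsMorse N (α n)) (hαi : ∀ n, Isometry (α n))
    (h : ∀ K : Set ℝ≥0, IsCompact K → TendstoUniformlyOn α β atTop K) :
    IsMorse (fun l e => N l (e + 2) + 2) β := by
  rintro l e a b hab σ hσ ⟨s₁, h₁⟩ ⟨s₂, h₂⟩ t ht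
  have hclose : ∀ R : ℝ≥0, ∀ᶠ n in atTop, ∀ s ≤ R, dist (β s) (α n s) < 1 := fun R => by
    filter_upwards [Metric.tendstoUniformlyOn_iff.1 (h (Set.Icc 0 R) isCompact_Icc) 1 one_pos]
      with n hn s hs using hn s ⟨zero_le, hs⟩
  -- Bounds, independently of `n`, the parameter of the point of `α n` near `σ t`, so that
  -- convergence on `[0, R]` suffices.
  let R : ℝ := (N l (e + 2) + 1 + dist (σ t) (β 0)) + 1
  have hR : 0 ≤ R := by positivity
  obtain ⟨n, hn1, hn2, hn3⟩ := ((hclose s₁).and ((hclose s₂).and (hclose R.toNNReal))).exists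
  obtain ⟨s, hs⟩ := (hα n).near_of_endpoints_near 1 l e hab hσ
    ⟨s₁, by rw [← h₁]; exact (hn1 s₁ le_rfl).le⟩ ⟨s₂, by rw [← h₂]; exact (hn2 s₂ le_rfl).le⟩ ht
  rw [mul_one] at hs
  have h0 := hn3 0 zero_le
  have hsR : s ≤ R.toNNReal := by
    rw [Real.le_toNNReal_iff_coe_le hR, ← dist_base_of_isometry (hαi n)]
    have := dist_triangle4 (α n s) (σ t) (β 0) (α n 0)
    rw [dist_comm (α n s) (σ t)] at this
    simp only [NNReal.coe_one] at hs
    simp only [R]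
    linarith
  refine ⟨s, ?_⟩
  have := dist_triangle_right (σ t) (β s) (α n s)
  have := hn3 s hsR
  push_cast at hs ⊢
  linarith

/-- `N`-Morse rays from `p` subconverge to Morse rays, with a uniform gauge. -/
theorem exists_subseq_tendsto_of_isMorse [ProperSpace X] {N : MorseGauge} (α : ℕ → MorseRay X p)
    (hα : ∀ n, IsMorse N (α n)) :
    ∃ φ : ℕ → ℕ, StrictMono φ ∧ ∃ β : MorseRay X p, ∀ K : Set ℝ≥0, IsCompact K →
      TendstoUniformlyOn (fun n => (α (φ n)).toFun) β.toFun atTop K := by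
  obtain ⟨φ, hφ, β, hβ, hβ0, hlim⟩ := exists_subseq_tendsto_of_isometry
    (fun n => (α n).toFun) (fun n => (α n).isometry) (fun n => (α n).base)
  exact ⟨φ, hφ, ⟨β, hβ, hβ0, _, IsMorse.of_tendsto (fun n => hα (φ n))
    (fun n => (α (φ n)).isometry) hlim⟩, hlim⟩

theorem mk_mem_of_tendsto {C : Set (MorseBoundary X p)} (hC : IsClosed C) {N : MorseGauge}
    {α : ℕ → MorseRay X p} (hα : ∀ n, IsMorse N (α n)) (hαC : ∀ n, MorseBoundary.mk (α n) ∈ C)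
    {β : MorseRay X p}
    (hlim : ∀ K : Set ℝ≥0, IsCompact K →
      TendstoUniformlyOn (fun n => (α n).toFun) β.toFun atTop K) :
    MorseBoundary.mk β ∈ C := by
  have hβ := IsMorse.of_tendsto hα (fun n => (α n).isometry) hlim
  -- The limit may leave the `N`-stratum; this gauge puts the sequence and its limit in one stratum.
  let M : MorseGauge := fun l e => max (N l e) (N l (e + 2) + 2)
  have hαM : ∀ n, IsMorse M (α n) := fun n => (hα n).mono fun _ _ => le_max_left _ _
  have hβM : IsMorse M β := hβ.mono fun _ _ => le_max_right _ _
  refine isClosed_iff.1 hC M (fun n => ⟨_, α n, rfl, hαM n⟩) ⟨_, β, rfl, hβM⟩ hαC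
    ⟨α, fun n => ⟨hαM n, rfl⟩, fun φ hφ => ⟨id, strictMono_id, β, rfl, fun K hK => ?_⟩⟩
  intro u hu
  exact hφ.tendsto_atTop.eventually (hlim K hK u hu)

end Rays

/-! ### Finite Hausdorff distance in terms of points -/

section Hausdorff

variable {A B Y : Type*} [MetricSpace Y]

theorem BoundedHausdorff.exists_near {γ : A → Y} {β : B → Y} (h : BoundedHausdorff γ β) :
    ∃ K : ℝ≥0, ∀ a, ∃ b, dist (γ a) (β b) ≤ K := by
  obtain ⟨r, hr⟩ : ∃ r : ℝ≥0, Metric.hausdorffEDist (Set.range γ) (Set.range β) < r :=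
    ENNReal.lt_iff_exists_nnreal_btwn.1 (lt_top_iff_ne_top.2 h) |>.imp fun r hr => hr.1
  refine ⟨r, fun a => ?_⟩
  obtain ⟨_, ⟨b, rfl⟩, hb⟩ :=
    Metric.exists_edist_lt_of_hausdorffEDist_lt (Set.mem_range_self a) hr
  rw [edist_nndist] at hb
  exact ⟨b, by exact_mod_cast hb.le⟩

theorem boundedHausdorff_of_near {γ : A → Y} {β : B → Y} (K : ℝ)
    (h : ∀ a, ∃ b, dist (γ a) (β b) ≤ K) (h' : ∀ b, ∃ a, dist (γ a) (β b) ≤ K) :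
    BoundedHausdorff γ β := by
  refine ne_top_of_le_ne_top (ENNReal.ofReal_ne_top (r := K))
    (Metric.hausdorffEDist_le_of_mem_edist ?_ ?_)
  · rintro _ ⟨a, rfl⟩
    obtain ⟨b, hb⟩ := h a
    exact ⟨β b, ⟨b, rfl⟩, by rw [edist_dist]; exact ENNReal.ofReal_le_ofReal hb⟩
  · rintro _ ⟨b, rfl⟩
    obtain ⟨a, ha⟩ := h' b
    exact ⟨γ a, ⟨a, rfl⟩, by rw [edist_comm, edist_dist]; exact ENNReal.ofReal_le_ofReal ha⟩

end Hausdorff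

/-! ### Quasi-geodesic rays near Morse rays -/

section QuasiGeodesics

variable {Y : Type*} [MetricSpace Y] {lam ε : ℝ}

theorem IsQuasiIsometricEmbedding.comp {A B : Type*} [MetricSpace A] [MetricSpace B]
    {lam' ε' : ℝ} {f : B → Y} {g : A → B} (hf : IsQuasiIsometricEmbedding lam ε f)
    (hg : IsQuasiIsometricEmbedding lam' ε' g) :
    IsQuasiIsometricEmbedding (lam * lam') (lam * ε' + ε) (f ∘ g) := by
  obtain ⟨h1, h2, h3⟩ := hf
  obtain ⟨k1, k2, k3⟩ := hg
  have hl : 0 < lam := by linarith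
  refine ⟨by nlinarith, by positivity, fun a b => ?_⟩
  have hh := h3 (g a) (g b)
  have hk := k3 a b
  simp only [Function.comp]
  constructor
  · have e1 : 1 / lam * (1 / lam' * dist a b - ε') ≤ 1 / lam * dist (g a) (g b) :=
      mul_le_mul_of_nonneg_left hk.1 (by positivity)
    have e2 : 1 / lam * (1 / lam' * dist a b - ε')
        = 1 / (lam * lam') * dist a b - 1 / lam * ε' := by
      field_simp
    have e3 : 1 / lam * ε' ≤ lam * ε' :=
      mul_le_mul_of_nonneg_right (((div_le_one hl).2 h1).trans h1) k2
    linarith [hh.1]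
  · have e1 := mul_le_mul_of_nonneg_left hk.2 hl.le
    rw [mul_add, ← mul_assoc] at e1
    linarith [hh.2]

theorem _root_.Isometry.isQuasiIsometricEmbedding {A : Type*} [MetricSpace A] {g : A → Y}
    (hg : Isometry g) : IsQuasiIsometricEmbedding 1 0 g :=
  ⟨le_rfl, le_rfl, fun a b => by simp [hg.dist_eq]⟩

theorem IsQuasiIsometricEmbedding.comp_isometry {A B : Type*} [MetricSpace A] [MetricSpace B]
    {f : B → Y} {g : A → B} (hf : IsQuasiIsometricEmbedding lam ε f) (hg : Isometry g) :
    IsQuasiIsometricEmbedding lam ε (f ∘ g) := by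
  simpa using hf.comp hg.isQuasiIsometricEmbedding

/-- A quasi-geodesic ray followed by a geodesic segment from an almost nearest point on it to a
given point is a quasi-geodesic. -/
theorem exists_concat_quasiGeodesic (hY : IsGeodesicSpace Y) {ρ : ℝ≥0 → Y}
    (hρ : IsQuasiIsometricEmbedding lam ε ρ) (q : Y) (T : ℝ≥0)
    (hT : ∀ t, dist (ρ T) q ≤ dist (ρ t) q + 1) :
    ∃ σ : ℝ → Y, (∀ t : ℝ≥0, t ≤ T → σ t = ρ t) ∧ σ (T + dist (ρ T) q) = q ∧
      IsQuasiIsometricEmbedding (3 * lam) (ε + 1)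
        (fun t : Set.Icc (0 : ℝ) (T + dist (ρ T) q) => σ t) := by
  obtain ⟨c, hc0, hc1, hc⟩ := hY (ρ T) q
  obtain ⟨h1, h2, h3⟩ := hρ
  have hl : 0 < lam := by linarith
  set L := dist (ρ T) q with hL
  have hL0 : 0 ≤ L := dist_nonneg
  let σ : ℝ → Y := fun t => if t ≤ T then ρ t.toNNReal else c (t - T)
  have hσ1 : ∀ t : ℝ, t ≤ T → σ t = ρ t.toNNReal := fun t ht => by simp only [σ, if_pos ht]
  have hσ2 : ∀ t : ℝ, (T : ℝ) ≤ t → σ t = c (t - T) := fun t ht => by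
    rcases ht.eq_or_lt with rfl | ht
    · rw [hσ1 _ le_rfl, sub_self, hc0, Real.toNNReal_coe]
    · simp only [σ, if_neg ht.not_ge]
  have key : ∀ s t : ℝ, 0 ≤ s → s ≤ t → t ≤ T + L →
      (t - s) ≤ 3 * lam * (dist (σ s) (σ t) + (ε + 1)) ∧
      dist (σ s) (σ t) ≤ 3 * lam * (t - s) + (ε + 1) := by
    intro s t hs hst htL
    have hρρ : ∀ u v : ℝ, 0 ≤ u → u ≤ v → v ≤ T →
        v - u ≤ lam * (dist (σ u) (σ v) + ε) ∧ dist (σ u) (σ v) ≤ lam * (v - u) + ε := by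
      intro u v hu huv hv
      rw [hσ1 u (huv.trans hv), hσ1 v hv]
      have hh := h3 u.toNNReal v.toNNReal
      rw [NNReal.dist_eq, Real.coe_toNNReal _ hu, Real.coe_toNNReal _ (hu.trans huv),
        abs_sub_comm, abs_of_nonneg (sub_nonneg.2 huv)] at hh
      refine ⟨?_, hh.2⟩
      have := hh.1
      rw [one_div_mul_eq_div, sub_le_iff_le_add, div_le_iff₀' hl] at this
      exact this
    have hcc : ∀ u v : ℝ, (T : ℝ) ≤ u → u ≤ v → v ≤ T + L → dist (σ u) (σ v) = v - u := by
      intro u v hu huv hv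
      rw [hσ2 u hu, hσ2 v (hu.trans huv), hc _ ⟨by linarith, by linarith⟩ _
        ⟨by linarith, by linarith⟩, abs_sub_comm, abs_of_nonneg (by linarith)]
      ring
    have hd : 0 ≤ dist (σ s) (σ t) := dist_nonneg
    rcases le_total t T with htT | htT
    · obtain ⟨k1, k2⟩ := hρρ s t hs hst htT
      constructor <;> nlinarith [mul_nonneg hl.le (add_nonneg hd h2)]
    rcases le_total (T : ℝ) s with hTs | hsT
    · have := hcc s t hTs hst htL
      rw [this]
      constructor <;> nlinarith [mul_nonneg hl.le h2]
    · obtain ⟨k1, k2⟩ := hρρ s T hs hsT le_rfl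
      have k3 := hcc T t le_rfl htT htL
      have k4 := hcc t (T + L) htT htL le_rfl
      have hq : σ (T + L) = q := by
        rw [hσ2 _ (by linarith), add_sub_cancel_left, hc1]
      have hTT : σ T = ρ T := by rw [hσ1 _ le_rfl, Real.toNNReal_coe]
      have k5 := hT s.toNNReal
      rw [← hσ1 s hsT, ← hq] at k5
      have k6 := dist_triangle (σ s) (σ t) (σ (T + L))
      have k7 := dist_triangle (σ s) (σ t) (σ T)
      rw [dist_comm (σ t) (σ T)] at k7
      have k8 := dist_triangle (σ s) (σ T) (σ t)
      -- The almost nearest choice of `ρ T` enters here: a shortcut from `σ s` through `σ t` to `q`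
      -- saves at most 1. With `k7`, `dist (σ s) (σ T)` is at most `2 * dist (σ s) (σ t) + 1`,
      -- whence the factor 3.
      have k9 : t - T ≤ dist (σ s) (σ t) + 1 := by linarith
      constructor
      · have : lam * (dist (σ s) (σ T) + ε) ≤ lam * (2 * dist (σ s) (σ t) + 1 + ε) :=
          mul_le_mul_of_nonneg_left (by linarith) hl.le
        nlinarith [mul_nonneg hl.le h2, mul_nonneg (sub_nonneg.2 h1) (add_nonneg hd zero_le_one)]
      · nlinarith [mul_nonneg hl.le (sub_nonneg.2 hsT),
          mul_nonneg (sub_nonneg.2 h1) (sub_nonneg.2 htT)]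
  refine ⟨σ, fun t ht => by rw [hσ1 _ (by exact_mod_cast ht), Real.toNNReal_coe],
    by rw [hσ2 _ (by linarith), add_sub_cancel_left, hc1], by linarith, by linarith, ?_⟩
  have key' : ∀ s t : ℝ, 0 ≤ s → s ≤ t → t ≤ T + L →
      1 / (3 * lam) * dist s t - (ε + 1) ≤ dist (σ s) (σ t) ∧
      dist (σ s) (σ t) ≤ 3 * lam * dist s t + (ε + 1) := by
    intro s t hs hst ht
    obtain ⟨k1, k2⟩ := key s t hs hst ht
    rw [Real.dist_eq, abs_sub_comm, abs_of_nonneg (sub_nonneg.2 hst)]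
    refine ⟨?_, k2⟩
    rw [one_div_mul_eq_div, sub_le_iff_le_add, div_le_iff₀' (by linarith)]
    exact k1
  rintro ⟨s, hs⟩ ⟨t, ht⟩
  rcases le_total s t with hst | hst
  · exact key' s t hs.1 hst ht.2
  · rw [dist_comm (⟨s, hs⟩ : Set.Icc (0 : ℝ) (T + L)), dist_comm (σ s)]
    exact key' t s ht.1 hst hs.2

/-- A quasi-geodesic ray at finite Hausdorff distance from a Morse ray with the same origin lies in
a uniform neighbourhood of it. -/
theorem IsMorse.near_of_boundedHausdorff (hY : IsGeodesicSpace Y) {N : MorseGauge}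
    {α ρ : ℝ≥0 → Y} (hα : IsMorse N α) (hαi : Isometry α)
    (hρ : IsQuasiIsometricEmbedding lam ε ρ) (h0 : ρ 0 = α 0) (hH : BoundedHausdorff α ρ)
    (l : Set.Ici (1 : ℝ)) (hl : (l : ℝ) = 3 * lam) (e : ℝ≥0) (he : (e : ℝ) = ε + 1) (t : ℝ≥0) :
    ∃ s, dist (ρ t) (α s) ≤ N l e := by
  obtain ⟨K, hK⟩ := hH.exists_near
  have h1 := hρ.1
  have h2 := hρ.2.1
  -- So far out that a point of `ρ` within `K + 1` of `α s` must have parameter at least `t`.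
  let s : ℝ := lam * t + ε + K + 2
  have hs : 0 ≤ s := by positivity
  set q := α s.toNNReal with hq
  obtain ⟨T, hT⟩ : ∃ T, dist (ρ T) q < (⨅ u, dist (ρ u) q) + 1 :=
    exists_lt_of_ciInf_lt (lt_add_one _)
  have hbdd : BddBelow (Set.range fun u => dist (ρ u) q) :=
    ⟨0, by rintro _ ⟨u, rfl⟩; exact dist_nonneg⟩
  have hT' : ∀ u, dist (ρ T) q ≤ dist (ρ u) q + 1 := fun u => by
    linarith [ciInf_le hbdd u]
  obtain ⟨u, hu⟩ := hK s.toNNReal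
  have hTq := hT' u
  rw [dist_comm (ρ u)] at hTq
  have hs0 := dist_base_of_isometry hαi s.toNNReal
  rw [← hq, Real.coe_toNNReal _ hs] at hs0
  have htT : t ≤ T := by
    by_contra! hlt
    have h5 := (hρ.2.2 T 0).2
    rw [NNReal.dist_eq, NNReal.coe_zero, sub_zero, abs_of_nonneg (NNReal.coe_nonneg T), h0] at h5
    have h6 : lam * T ≤ lam * t := mul_le_mul_of_nonneg_left (by exact_mod_cast hlt.le) (by linarith)
    have h7 := dist_triangle_left q (α 0) (ρ T)
    simp only [s] at hs0
    linarith
  obtain ⟨σ, hσ1, hσ2, hσ⟩ := exists_concat_quasiGeodesic hY hρ q T hT'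
  rw [← hl, ← he] at hσ
  obtain ⟨r, hr⟩ := hα l e 0 (T + dist (ρ T) q) (by positivity) σ hσ
    ⟨0, by rw [← h0, ← hσ1 0 zero_le, NNReal.coe_zero]⟩ ⟨_, hσ2.symm⟩ t
    ⟨t.2, by have : (t : ℝ) ≤ T := by exact_mod_cast htT
             linarith [dist_nonneg (x := ρ T) (y := q)]⟩
  exact ⟨r, by rwa [hσ1 t htT] at hr⟩

/-- If a quasi-geodesic ray lies near a geodesic ray with the same origin, then conversely the
geodesic ray lies near the quasi-geodesic ray. -/
theorem IsQuasiIsometricEmbedding.near_of_near {α ρ : ℝ≥0 → Y} (hαi : Isometry α)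
    (hρ : IsQuasiIsometricEmbedding lam ε ρ) (h0 : ρ 0 = α 0) {D : ℝ}
    (hD : ∀ t, ∃ s, dist (ρ t) (α s) ≤ D) (s : ℝ≥0) :
    ∃ t, dist (α s) (ρ t) ≤ 2 * D + lam + ε := by
  classical
  have hl : 0 < lam := by linarith [hρ.1]
  -- Discrete intermediate value argument: at integer times the distance from the origin grows by at
  -- most `lam + ε` per step, so at the first time it exceeds `s` it is within `lam + ε` of `s`.
  have hex : ∃ n : ℕ, (s : ℝ) < dist (ρ n) (ρ 0) := by
    obtain ⟨n, hn⟩ := exists_nat_gt (lam * (s + ε))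
    refine ⟨n, ?_⟩
    have h5 := (hρ.2.2 n 0).1
    rw [NNReal.dist_eq, NNReal.coe_zero, sub_zero, abs_of_nonneg (NNReal.coe_nonneg _),
      NNReal.coe_natCast, one_div_mul_eq_div] at h5
    have : s + ε < n / lam := (lt_div_iff₀' hl).2 hn
    linarith
  have hn := Nat.find_spec hex
  have hmin := fun m => Nat.find_min hex (m := m)
  set n := Nat.find hex
  obtain ⟨m, hm⟩ : ∃ m, n = m + 1 := Nat.exists_eq_succ_of_ne_zero fun hz => by
    rw [hz] at hn
    simp at hn
  have hm' := not_lt.1 (hmin m (by omega))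
  have h5 := (hρ.2.2 n m).2
  rw [hm] at h5 hn
  have h6 : dist ((m + 1 : ℕ) : ℝ≥0) (m : ℝ≥0) = 1 := by
    rw [NNReal.dist_eq]; simp
  rw [h6] at h5
  have h7 := dist_triangle (ρ (m + 1 : ℕ)) (ρ m) (ρ 0)
  obtain ⟨r, hr⟩ := hD (m + 1 : ℕ)
  refine ⟨(m + 1 : ℕ), ?_⟩
  have h8 := dist_base_of_isometry hαi r
  rw [← h0] at h8
  have h9 := abs_le.1 (abs_dist_sub_le (ρ (m + 1 : ℕ)) (α r) (ρ 0))
  have h10 : dist (α s) (α r) ≤ D + lam + ε := by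
    rw [hαi.dist_eq, NNReal.dist_eq, abs_le]
    constructor <;> linarith
  linarith [dist_triangle_right (α s) (ρ (m + 1 : ℕ)) (α r)]

end QuasiGeodesics

/-! ### Corresponding rays under `f`, and the boundary map -/

section QuasiIsometricEmbeddings

variable {X Y : Type*} [MetricSpace X] [MetricSpace Y] {f : X → Y} {p : X} {lam ε : ℝ}

theorem MorseRay.comp_quasiIsometricEmbedding (hf : IsQuasiIsometricEmbedding lam ε f)
    (γ : MorseRay X p) : IsQuasiIsometricEmbedding lam ε (f ∘ γ) :=
  hf.comp_isometry γ.isometry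

theorem MorseRay.comp_base_eq (γ : MorseRay X p) (β : MorseRay Y (f p)) :
    (f ∘ γ) 0 = β 0 := by
  rw [Function.comp, γ.base, β.base]

/-- The image of a ray under a quasi-isometric embedding lies in a neighbourhood, uniform in the
gauge, of any Morse ray with the same origin at finite Hausdorff distance. -/
theorem exists_uniform_near (hY : IsGeodesicSpace Y) (hf : IsQuasiIsometricEmbedding lam ε f)
    (p : X) (N : MorseGauge) :
    ∃ D : ℝ≥0, ∀ (γ : MorseRay X p) (β : MorseRay Y (f p)), IsMorse N β →
      BoundedHausdorff β (f ∘ γ) → ∀ t, ∃ s, dist (f (γ t)) (β s) ≤ D := by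
  have h1 := hf.1
  have h2 := hf.2.1
  exact ⟨N ⟨3 * lam, by rw [Set.mem_Ici]; linarith⟩ ⟨ε + 1, by linarith⟩, fun γ β hβ hH =>
    hβ.near_of_boundedHausdorff hY β.isometry (γ.comp_quasiIsometricEmbedding hf)
      (MorseRay.comp_base_eq γ β) hH _ rfl _ rfl⟩

/-- A ray whose image is close to an `N`-Morse ray is Morse with a uniform gauge. -/
theorem exists_gauge_of_image (hY : IsGeodesicSpace Y) (hf : IsQuasiIsometricEmbedding lam ε f)
    (p : X) (N : MorseGauge) :
    ∃ N' : MorseGauge, ∀ (γ : MorseRay X p) (β : MorseRay Y (f p)), IsMorse N β →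
      BoundedHausdorff β (f ∘ γ) → IsMorse N' γ := by
  obtain ⟨D, hD⟩ := exists_uniform_near hY hf p N
  have h1 := hf.1
  have h2 := hf.2.1
  have hl : 0 < lam := by linarith
  let l' : Set.Ici (1 : ℝ) → Set.Ici (1 : ℝ) := fun l =>
    ⟨lam * l, one_le_mul_of_one_le_of_one_le h1 l.2⟩
  let e' : ℝ≥0 → ℝ≥0 := fun e => ⟨lam * e + ε, by positivity⟩
  -- The summands: from `f ∘ σ` to `β`, from `β` back to `f ∘ γ`, and the loss in the lower bound
  -- for `f`.
  refine ⟨fun l e => (lam * ((N (l' l) (e' e + 2 * D) + D) + (2 * D + lam + ε) + ε)).toNNReal,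
    fun γ β hβ hH l e a b hab σ hσ ha hb t ht => ?_⟩
  have hnear := hD γ β hβ hH
  obtain ⟨⟨u, hu⟩, v, hv⟩ := And.intro ha hb
  obtain ⟨s, hs⟩ := hβ.near_of_endpoints_near D (l' l) (e' e) hab (σ := f ∘ σ)
    (hf.comp hσ) (by rw [Function.comp, ← hu]; exact hnear u)
    (by rw [Function.comp, ← hv]; exact hnear v) ht
  obtain ⟨r, hr⟩ := (γ.comp_quasiIsometricEmbedding hf).near_of_near β.isometry
    (MorseRay.comp_base_eq γ β) hnear s
  refine ⟨r, ?_⟩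
  refine le_trans ?_ (Real.le_coe_toNNReal _)
  have h3 := (hf.2.2 (σ t) (γ r)).1
  rw [one_div_mul_eq_div, sub_le_iff_le_add, div_le_iff₀' hl] at h3
  refine h3.trans (mul_le_mul_of_nonneg_left ?_ hl.le)
  have := dist_triangle (f (σ t)) (β s) (f (γ r))
  simp only [Function.comp] at hs hr
  linarith

/-- Uniform closeness of image rays passes to limits. -/
theorem boundedHausdorff_of_tendsto (hf : IsQuasiIsometricEmbedding lam ε f)
    {γ : ℕ → MorseRay X p} {β : ℕ → MorseRay Y (f p)} {D : ℝ≥0}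
    (hD : ∀ n t, ∃ s, dist (f (γ n t)) (β n s) ≤ D) {γ' : MorseRay X p} {β' : MorseRay Y (f p)}
    (hγ : ∀ K : Set ℝ≥0, IsCompact K →
      TendstoUniformlyOn (fun n => (γ n).toFun) γ'.toFun atTop K)
    (hβ : ∀ K : Set ℝ≥0, IsCompact K →
      TendstoUniformlyOn (fun n => (β n).toFun) β'.toFun atTop K) :
    BoundedHausdorff β' (f ∘ γ') := by
  have h1 := hf.1
  have h2 := hf.2.1
  -- As `f` may be discontinuous, passing from `γ' t` to the 1-close `γ n t` costs `lam + ε`; the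
  -- final 1 is for passing from `β n` to `β'`.
  have hnear : ∀ t, ∃ s, dist ((f ∘ γ') t) (β' s) ≤ D + lam + ε + 1 := by
    intro t
    let R : ℝ := D + (lam * t + ε)
    have hR : 0 ≤ R := by positivity
    obtain ⟨n, hn1, hn2⟩ := ((Metric.tendstoUniformlyOn_iff.1
      (hγ {t} isCompact_singleton) 1 one_pos).and (Metric.tendstoUniformlyOn_iff.1
      (hβ (Set.Icc 0 R.toNNReal) isCompact_Icc) 1 one_pos)).exists
    obtain ⟨s, hs⟩ := hD n t
    have h3 := hn1 t rfl
    have h4 := (hf.2.2 (γ' t) (γ n t)).2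
    have h5 : lam * dist (γ' t) (γ n t) ≤ lam * 1 :=
      mul_le_mul_of_nonneg_left h3.le (by linarith)
    have h6 := (hf.2.2 (γ n t) (γ n 0)).2
    rw [dist_base_of_isometry (γ n).isometry, (γ n).base] at h6
    have h7 := dist_base_of_isometry (β n).isometry s
    rw [(β n).base] at h7
    have h8 := dist_triangle_left (β n s) (f p) (f (γ n t))
    have h9 := hn2 s ⟨zero_le, by
      rw [Real.le_toNNReal_iff_coe_le hR]; simp only [R]; linarith⟩
    refine ⟨s, ?_⟩
    have h10 := dist_triangle4 (f (γ' t)) (f (γ n t)) (β n s) (β' s)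
    rw [dist_comm (β n s) (β' s)] at h10
    simp only [Function.comp]
    linarith
  have hρ := γ'.comp_quasiIsometricEmbedding hf
  have hback := hρ.near_of_near β'.isometry (MorseRay.comp_base_eq γ' β') hnear
  refine boundedHausdorff_of_near (2 * (D + lam + ε + 1) + lam + ε) hback fun t => ?_
  obtain ⟨s, hs⟩ := hnear t
  refine ⟨s, ?_⟩
  rw [dist_comm]
  have := D.2
  linarith

theorem boundaryMap_injective (hf : IsQuasiIsometricEmbedding lam ε f)
    (h : InducesMorsePreserving f p) : Function.Injective (boundaryMap f p hf h) := by
  intro x y hxy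
  obtain ⟨γ, rfl⟩ := Quotient.exists_rep x
  obtain ⟨γ', rfl⟩ := Quotient.exists_rep y
  obtain ⟨β, hβ⟩ := Quotient.exists_rep (boundaryMap f p hf h (MorseBoundary.mk γ'))
  have k1 := (boundaryMap_mk_eq_iff f p hf h γ β).1 (hxy.trans hβ.symm)
  have k2 := (boundaryMap_mk_eq_iff f p hf h γ' β).1 hβ.symm
  have hl : 0 < lam := by linarith [hf.1]
  have pull : ∀ {a b : MorseRay X p}, BoundedHausdorff (f ∘ a) (f ∘ b) →
      ∃ K : ℝ, ∀ s, ∃ t, dist (a s) (b t) ≤ K := by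
    intro a b hab
    obtain ⟨K, hK⟩ := hab.exists_near
    refine ⟨lam * (K + ε), fun s => (hK s).imp fun t ht => ?_⟩
    have h3 := (hf.2.2 (a s) (b t)).1
    rw [one_div_mul_eq_div, sub_le_iff_le_add, div_le_iff₀' hl] at h3
    exact h3.trans (mul_le_mul_of_nonneg_left (by simpa using ht) hl.le)
  have k3 := k1.symm.trans k2
  obtain ⟨K, hK⟩ := pull k3
  obtain ⟨K', hK'⟩ := pull k3.symm
  refine (MorseBoundary.mk_eq_mk_iff γ γ').2 (boundedHausdorff_of_near (max K K')
    (fun s => (hK s).imp fun t ht => ht.trans (le_max_left _ _))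
    (fun s => (hK' s).imp fun t ht => ?_))
  rw [dist_comm]
  exact ht.trans (le_max_right _ _)

theorem continuous_boundaryMap [ProperSpace Y] (hY : IsGeodesicSpace Y)
    (hf : IsQuasiIsometricEmbedding lam ε f) (h : InducesMorsePreserving f p) :
    Continuous (boundaryMap f p hf h) := by
  refine continuous_iff_isClosed.2 fun C hC => isClosed_iff.2 fun N x ξ hx ⟨α, hα, hconv⟩ => ?_
  -- One convergent subsequence is enough, since its limit already represents `ξ`.
  obtain ⟨ψ, -, γ, hγ, hlim⟩ := hconv id strictMono_id
  obtain ⟨N', hN'⟩ := h N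
  choose β hβM hβ using fun n => hN' (α (ψ n)) (hα _).1
  obtain ⟨χ, hχ, b, hb⟩ := exists_subseq_tendsto_of_isMorse β hβM
  obtain ⟨D, hD⟩ := exists_uniform_near hY hf p N'
  have hH : BoundedHausdorff b (f ∘ γ) := boundedHausdorff_of_tendsto hf
    (γ := fun n => α (ψ (χ n))) (fun n => hD _ _ (hβM (χ n)) (hβ (χ n)))
    (fun K hK u hu => hχ.tendsto_atTop.eventually (hlim K hK u hu)) hb
  rw [Set.mem_preimage, ← hγ, (boundaryMap_mk_eq_iff f p hf h γ b).2 hH]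
  refine mk_mem_of_tendsto hC (fun n => hβM (χ n)) (fun n => ?_) hb
  rw [← (boundaryMap_mk_eq_iff f p hf h _ _).2 (hβ (χ n)), (hα _).2]
  exact hx _

theorem isClosedMap_boundaryMap [ProperSpace X] (hY : IsGeodesicSpace Y)
    (hf : IsQuasiIsometricEmbedding lam ε f) (h : InducesMorsePreserving f p) :
    IsClosedMap (boundaryMap f p hf h) := by
  refine fun C hC => isClosed_iff.2 fun N y η hy ⟨β, hβ, hconv⟩ => ?_
  obtain ⟨ψ, -, b, hb, hlim⟩ := hconv id strictMono_id
  choose x hxC hx using fun n => hy (ψ n)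
  choose γ hγ using fun n => Quotient.exists_rep (x n)
  have hH : ∀ n, BoundedHausdorff (β (ψ n)) (f ∘ γ n) := fun n =>
    (boundaryMap_mk_eq_iff f p hf h (γ n) (β (ψ n))).1 <| by
      rw [(hβ _).2, ← hx n, ← hγ n]; rfl
  obtain ⟨N', hN'⟩ := exists_gauge_of_image hY hf p N
  -- The representatives `γ n` were arbitrary, with no common gauge; their images being near
  -- `N`-Morse rays supplies one.
  have hγM : ∀ n, IsMorse N' (γ n) := fun n => hN' _ _ (hβ (ψ n)).1 (hH n)
  obtain ⟨χ, hχ, c, hc⟩ := exists_subseq_tendsto_of_isMorse γ hγM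
  obtain ⟨D, hD⟩ := exists_uniform_near hY hf p N
  refine ⟨MorseBoundary.mk c, mk_mem_of_tendsto hC (fun n => hγM (χ n))
    (fun n => by rw [MorseBoundary.mk, hγ]; exact hxC _) hc, ?_⟩
  rw [← hb, boundaryMap_mk_eq_iff]
  exact boundedHausdorff_of_tendsto hf (β := fun n => β (ψ (χ n)))
    (fun n => hD _ _ (hβ (ψ (χ n))).1 (hH (χ n))) hc
    (fun K hK u hu => hχ.tendsto_atTop.eventually (hlim K hK u hu))

end QuasiIsometricEmbeddings

end MorseBdry

theorem mainTheorem5 {X Y : Type*} [MetricSpace X] [ProperSpace X] [MetricSpace Y] [ProperSpace Y]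
    (hX : MorseBdry.IsGeodesicSpace X) (hY : MorseBdry.IsGeodesicSpace Y)
    (f : X → Y) (lam ε : ℝ) (hf : MorseBdry.IsQuasiIsometricEmbedding lam ε f)
    (p : X) (h : MorseBdry.InducesMorsePreserving f p) :
    Topology.IsEmbedding (MorseBdry.boundaryMap f p hf h) := by
  exact (Topology.IsClosedEmbedding.of_continuous_injective_isClosedMap
    (MorseBdry.continuous_boundaryMap hY hf h) (MorseBdry.boundaryMap_injective hf h)
    (MorseBdry.isClosedMap_boundaryMap hY hf h)).isEmbedding
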